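/- For $k\ge 1$, positive integers $s_1,\dots,s_k$ and real $x_1,\dots,x_k$, let \[ \operatorname{Li}^\star_{s_1,\dots,s_k}(x_1,\dots,x_k)=\sum_{n_1\ge\cdots\ge n_k\ge 1}\ \prod_{i=1}^k\frac{x_i^{n_i}}{n_i^{s_i}}, \qquad \zeta^\star(s_1,\dots,s_k)=\operatorname{Li}^\star_{s_1,\dots,s_k}(1,\dots,1). \] Write $\{1\}_r$ for the string of $r$ ones, $\bigsqcup$ for the concatenation of strings, $|\boldsymbol s|$ for the sum of the components of $\boldsymbol s$, and $\delta_{i,j}$ for the Kronecker delta. Let $d\ge 1$ be an integer, let $m_1,\dots,m_d,u_1,\dots,u_d$ be non-negative integers with $u_d\ge 1$, and let $\boldsymbol s=\bigl(\bigsqcup_{i=1}^d\{m_i+2,\{1\}_{u_i}\}\bigr)$. Then for every $p\in(0,1)$ the three series below converge, and \[ \begin{aligned} \zeta^\star(\boldsymbol s) &=\operatorname{Li}^\star_{\{1\}_{|\boldsymbol s|}}\Bigl(\textstyle\bigsqcup_{i=1}^d\bigl\{1-p,\{1\}_{m_i},\tfrac1{1-p},\{1\}_{u_i}\bigr\}\Bigr)\\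 &\quad-\operatorname{Li}^\star_{\{1\}_{|\boldsymbol s|}}\Bigl(\textstyle\bigsqcup_{i=1}^d\bigl\{1-p,\{1\}_{m_i},\tfrac1{1-p},\{1\}_{u_i-\delta_{i,d}}\bigr\},\,1-p\Bigr). \end{aligned} \] -/

import Mathlib

/-- The index set of the nested series: tuples `n₁ ≥ n₂ ≥ ⋯ ≥ n_k ≥ 1` of positive integers. -/
def StarIndex (k : ℕ) : Type :=
  {n : Fin k → ℕ // Antitone n ∧ ∀ i, 1 ≤ n i}

/-- The general term `∏ᵢ xᵢ ^ nᵢ / nᵢ ^ sᵢ` of the multiple polylogarithm series. -/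
noncomputable def starTerm {k : ℕ} (s : Fin k → ℕ) (x : Fin k → ℝ) (n : StarIndex k) : ℝ :=
  ∏ i, x i ^ n.1 i / (n.1 i : ℝ) ^ s i

/-- The series defining `Li⋆_{s₁,…,s_k}(x₁,…,x_k)` converges (absolutely). -/
def StarPolylogConverges {k : ℕ} (s : Fin k → ℕ) (x : Fin k → ℝ) : Prop :=
  Summable (starTerm s x)

/-- The multiple polylogarithm `Li⋆_{s₁,…,s_k}(x₁,…,x_k)`. -/
noncomputable def starPolylog {k : ℕ} (s : Fin k → ℕ) (x : Fin k → ℝ) : ℝ :=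
  ∑' n : StarIndex k, starTerm s x n

/-- The multiple zeta-star value `ζ⋆(s) = Li⋆_s(1,…,1)` of a string `s`. -/
noncomputable def zetaStar (s : List ℕ) : ℝ :=
  starPolylog s.get (fun _ => 1)

/-- The string `⊔_{i=1}^d {mᵢ + 2, {1}_{uᵢ}}`. -/
def blockExponents {d : ℕ} (m u : Fin d → ℕ) : List ℕ :=
  (List.ofFn fun i => (m i + 2) :: List.replicate (u i) 1).flatten

/-- The string `⊔_{i=1}^d {1 - p, {1}_{mᵢ}, 1/(1-p), {1}_{uᵢ}}`. -/
noncomputable def blockArgs (p : ℝ) {d : ℕ} (m u : Fin d → ℕ) : List ℝ :=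
  (List.ofFn fun i =>
    [1 - p] ++ List.replicate (m i) 1 ++ [1 / (1 - p)] ++ List.replicate (u i) 1).flatten

/-- The Kronecker delta `δ_{i,d}`; the index `i : Fin d` stands for the integer `i + 1`. -/
def deltaLast {d : ℕ} (i : Fin d) : ℕ := if (i : ℕ) + 1 = d then 1 else 0

/-- The string `⊔_{i=1}^d {1 - p, {1}_{mᵢ}, 1/(1-p), {1}_{uᵢ - δ_{i,d}}}, 1 - p`. -/
noncomputable def blockArgsEnd (p : ℝ) {d : ℕ} (m u : Fin d → ℕ) : List ℝ :=
  blockArgs p m (fun i => u i - deltaLast i) ++ [1 - p]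

theorem sum_blockExponents {d : ℕ} (m u : Fin d → ℕ) :
    (blockExponents m u).sum = ∑ i, (m i + 2 + u i) := by
  simp [blockExponents, List.sum_flatten, List.map_ofFn, List.sum_ofFn]

theorem length_blockArgs (p : ℝ) {d : ℕ} (m u : Fin d → ℕ) :
    (blockArgs p m u).length = (blockExponents m u).sum := by
  rw [sum_blockExponents]
  simp only [blockArgs, List.length_flatten, List.map_ofFn, List.sum_ofFn]
  refine Finset.sum_congr rfl fun i _ => ?_
  simp
  omega

theorem length_blockArgsEnd (p : ℝ) {d : ℕ} (hd : 1 ≤ d) (m u : Fin d → ℕ)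
    (hu : 1 ≤ u ⟨d - 1, by omega⟩) :
    (blockArgsEnd p m u).length = (blockExponents m u).sum := by
  have h1 : (∑ i : Fin d, deltaLast i) = 1 := by
    rw [Finset.sum_eq_single (⟨d - 1, by omega⟩ : Fin d)]
    · simp [deltaLast]; omega
    · intro i _ hi
      have : (i : ℕ) + 1 ≠ d := fun h => hi (Fin.ext (by simp; omega))
      simp [deltaLast, this]
    · simp
  rw [blockArgsEnd, List.length_append, length_blockArgs, sum_blockExponents,
    sum_blockExponents, List.length_singleton]
  conv_lhs => rw [← h1]
  rw [← Finset.sum_add_distrib]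
  refine Finset.sum_congr rfl fun i _ => ?_
  have : deltaLast i ≤ u i := by
    by_cases h : (i : ℕ) + 1 = d
    · have hi : i = ⟨d - 1, by omega⟩ := Fin.ext (by simp; omega)
      rw [← hi] at hu
      simp [deltaLast, h]; omega
    · simp [deltaLast, h]
  omega

/-! Write D_y for `dividedSum y` and B for `binomialMean p`. Truncating each series at n₁ ≤ N gives
a composition of operators D_y evaluated at N: D_0 and D_1 for ζ⋆, D_{1-p} and D_1 for the two
polylogarithms, whose compositions differ only in the input, 1 or (1-p)^n. On sequences vanishing at
0, B D_0 = D_{1-p} B and B D_1 = D_1 B (`binomialMean_blockOps`). Since B sends the indicator of n ≥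
1 to 1 - (1-p)^N, it turns the truncated ζ⋆ into the difference of the truncated polylogarithms. B
preserves limits (`tendsto_binomialMean`), so this difference tends to ζ⋆. The terms are
nonnegative, so convergence only needs bounded truncations: `exists_blockOps_zero_one_le` for ζ⋆,
then a comparison with the convergent difference for the other two. -/

/-- The operator `g ↦ ∑_{j=1}^N y ^ (N - j) g(j) / j` on sequences. -/
noncomputable def dividedSum (y : ℝ) (g : ℕ → ℝ) (N : ℕ) : ℝ :=
  ∑ j ∈ Finset.Icc 1 N, y ^ (N - j) * (g j / j)

theorem dividedSum_zero_right (y : ℝ) (g : ℕ → ℝ) : dividedSum y g 0 = 0 := by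
  simp [dividedSum]

theorem dividedSum_succ (y : ℝ) (g : ℕ → ℝ) (N : ℕ) :
    dividedSum y g (N + 1) = y * dividedSum y g N + g (N + 1) / ((N + 1 : ℕ) : ℝ) := by
  rw [dividedSum, Finset.sum_Icc_succ_top (by omega), dividedSum, Finset.mul_sum]
  congr 1
  · refine Finset.sum_congr rfl fun j hj => ?_
    rw [Finset.mem_Icc] at hj
    rw [Nat.sub_add_comm hj.2, pow_succ]
    ring
  · simp

theorem dividedSum_sub (y : ℝ) (g h : ℕ → ℝ) :
    dividedSum y (g - h) = dividedSum y g - dividedSum y h := by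
  ext N
  simp only [dividedSum, Pi.sub_apply, ← Finset.sum_sub_distrib]
  exact Finset.sum_congr rfl fun j _ => by ring

theorem dividedSum_smul (y c : ℝ) (g : ℕ → ℝ) :
    dividedSum y (c • g) = c • dividedSum y g := by
  ext N
  simp only [dividedSum, Pi.smul_apply, smul_eq_mul, Finset.mul_sum]
  exact Finset.sum_congr rfl fun j _ => by ring

theorem dividedSum_mono {y : ℝ} (hy : 0 ≤ y) {g h : ℕ → ℝ} (hgh : ∀ n, 1 ≤ n → g n ≤ h n)
    (N : ℕ) : dividedSum y g N ≤ dividedSum y h N := by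
  refine Finset.sum_le_sum fun j hj => ?_
  have := hgh j (Finset.mem_Icc.1 hj).1
  gcongr

/-- Since 0 ^ 0 = 1, only the term j = n survives. -/
theorem dividedSum_zero_left (g : ℕ → ℝ) {n : ℕ} (hn : 1 ≤ n) :
    dividedSum 0 g n = g n / n := by
  obtain ⟨N, rfl⟩ := Nat.exists_eq_add_of_le' hn
  rw [dividedSum_succ]
  simp

theorem iterate_dividedSum_zero_left (g : ℕ → ℝ) {n : ℕ} (hn : 1 ≤ n) (k : ℕ) :
    (dividedSum 0)^[k] g n = g n / (n : ℝ) ^ k := by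
  induction k with
  | zero => simp
  | succ k ih =>
    rw [Function.iterate_succ_apply', dividedSum_zero_left _ hn, ih, pow_succ, div_div]

/-! ### Binomial means: intertwining relations and preservation of limits -/

/-- The expectation of `f` under the binomial distribution with parameters `N` and `p`. -/
noncomputable def binomialMean (p : ℝ) (f : ℕ → ℝ) (N : ℕ) : ℝ :=
  ∑ n ∈ Finset.range (N + 1), (N.choose n : ℝ) * p ^ n * (1 - p) ^ (N - n) * f n

/-- Pascal's rule: condition on the outcome of one trial. -/
theorem binomialMean_succ (p : ℝ) (f : ℕ → ℝ) (N : ℕ) :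
    binomialMean p f (N + 1) =
      (1 - p) * binomialMean p f N + p * binomialMean p (fun n => f (n + 1)) N := by
  have h : ∀ n, ((N + 1).choose (n + 1) : ℝ) = N.choose n + N.choose (n + 1) := fun n => by
    exact_mod_cast Nat.choose_succ_succ N n
  -- The added term vanishes because `N.choose (N + 1) = 0`; it aligns the two ranges.
  have h2 : binomialMean p f N = ∑ n ∈ Finset.range (N + 2),
      (N.choose n : ℝ) * p ^ n * (1 - p) ^ (N - n) * f n := by
    rw [Finset.sum_range_succ _ (N + 1)]
    simp [binomialMean]
  rw [h2, Finset.sum_range_succ', binomialMean, Finset.sum_range_succ', binomialMean,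
    mul_add, Finset.mul_sum, Finset.mul_sum, add_right_comm, ← Finset.sum_add_distrib]
  congr 1
  · refine Finset.sum_congr rfl fun n hn => ?_
    rw [h, Nat.add_sub_add_right]
    rcases (Finset.mem_range_succ_iff.1 hn).lt_or_eq with hlt | rfl
    · obtain ⟨k, rfl⟩ := Nat.exists_eq_add_of_lt hlt
      have e1 : n + k + 1 - n = k + 1 := by omega
      have e2 : n + k + 1 - (n + 1) = k := by omega
      rw [e1, e2]
      ring
    · simp
      ring
  · simp
    ring

theorem binomialMean_add (p : ℝ) (f g : ℕ → ℝ) (N : ℕ) :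
    binomialMean p (fun n => f n + g n) N = binomialMean p f N + binomialMean p g N := by
  simp only [binomialMean, mul_add, Finset.sum_add_distrib]

theorem binomialMean_const (p c : ℝ) (N : ℕ) : binomialMean p (fun _ => c) N = c := by
  have h := add_pow p (1 - p) N
  rw [add_sub_cancel, one_pow] at h
  rw [binomialMean, ← Finset.sum_mul]
  conv_rhs => rw [← one_mul c, h]
  congr 1
  exact Finset.sum_congr rfl fun n _ => by ring

theorem binomialMean_pos_indicator (p : ℝ) (N : ℕ) :
    binomialMean p (fun n => if n = 0 then 0 else 1) N = 1 - (1 - p) ^ N := by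
  have h := binomialMean_const p 1 N
  rw [binomialMean, Finset.sum_range_succ'] at h
  rw [eq_sub_iff_add_eq, binomialMean, Finset.sum_range_succ']
  simpa using h

/-- The absorption identity for binomial coefficients, in terms of binomial means. -/
theorem mul_binomialMean_shift_div (p : ℝ) {g : ℕ → ℝ} (hg : g 0 = 0) (N : ℕ) :
    p * binomialMean p (fun n => g (n + 1) / ((n + 1 : ℕ) : ℝ)) N =
      binomialMean p g (N + 1) / ((N + 1 : ℕ) : ℝ) := by
  rw [binomialMean, binomialMean, Finset.sum_range_succ' _ (N + 1), hg, mul_zero, add_zero,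
    Finset.mul_sum, Finset.sum_div]
  refine Finset.sum_congr rfl fun n _ => ?_
  have h : ((N + 1 : ℕ) : ℝ) * N.choose n = (N + 1).choose (n + 1) * ((n + 1 : ℕ) : ℝ) := by
    exact_mod_cast Nat.add_one_mul_choose_eq N n
  have h1 : ((N + 1 : ℕ) : ℝ) ≠ 0 := by positivity
  have h2 : ((n + 1 : ℕ) : ℝ) ≠ 0 := by positivity
  rw [Nat.add_sub_add_right]
  field_simp
  linear_combination (p ^ (n + 1) * (1 - p) ^ (N - n) * g (n + 1)) * h

theorem binomialMean_zero (p : ℝ) (f : ℕ → ℝ) : binomialMean p f 0 = f 0 := by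
  simp [binomialMean]

/-- Both sides vanish at 0 and satisfy F(N+1) = (1-p) F(N) + Bg(N+1)/(N+1), by Pascal's rule and
absorption. -/
theorem binomialMean_dividedSum_zero_left (p : ℝ) {g : ℕ → ℝ} (hg : g 0 = 0) :
    binomialMean p (dividedSum 0 g) = dividedSum (1 - p) (binomialMean p g) := by
  ext N
  induction N with
  | zero => rw [binomialMean_zero, dividedSum_zero_right, dividedSum_zero_right]
  | succ N ih =>
    rw [binomialMean_succ, dividedSum_succ, ih, ← mul_binomialMean_shift_div p hg]
    simp [dividedSum_succ]

/-- As for D_0, but the shift of D_1 g contributes a further p F(N), so the coefficient of F(N)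
becomes (1-p) + p = 1. -/
theorem binomialMean_dividedSum_one_left (p : ℝ) {g : ℕ → ℝ} (hg : g 0 = 0) :
    binomialMean p (dividedSum 1 g) = dividedSum 1 (binomialMean p g) := by
  ext N
  induction N with
  | zero => rw [binomialMean_zero, dividedSum_zero_right, dividedSum_zero_right]
  | succ N ih =>
    rw [binomialMean_succ, dividedSum_succ, ← ih, ← mul_binomialMean_shift_div p hg]
    simp only [dividedSum_succ, one_mul, binomialMean_add]
    ring

theorem tendsto_choose_mul_pow_sub {q : ℝ} (hq0 : 0 < q) (hq1 : q < 1) (n : ℕ) :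
    Filter.Tendsto (fun N : ℕ => (N.choose n : ℝ) * q ^ (N - n)) Filter.atTop (nhds 0) := by
  have h := (tendsto_pow_const_mul_const_pow_of_abs_lt_one n
    (by rwa [abs_of_pos hq0] : |q| < 1)).mul_const ((q ^ n)⁻¹)
  rw [zero_mul] at h
  refine squeeze_zero' (Filter.Eventually.of_forall fun N => by positivity) ?_ h
  filter_upwards [Filter.eventually_ge_atTop n] with N hN
  rw [mul_assoc, pow_sub₀ _ hq0.ne' hN]
  gcongr
  exact_mod_cast Nat.choose_le_pow N n

/-- Toeplitz argument: the weights are nonnegative with sum 1, and the mass on any fixed initial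
segment tends to 0. -/
theorem tendsto_binomialMean {p : ℝ} (hp : p ∈ Set.Ioo (0 : ℝ) 1) {g : ℕ → ℝ} {L : ℝ}
    (hg : Filter.Tendsto g Filter.atTop (nhds L)) :
    Filter.Tendsto (binomialMean p g) Filter.atTop (nhds L) := by
  obtain ⟨hp0, hp1⟩ := hp
  have hq0 : 0 < 1 - p := by linarith
  have hq1 : 1 - p < 1 := by linarith
  rw [Metric.tendsto_atTop] at hg ⊢
  intro ε hε
  obtain ⟨M, hM⟩ := hg (ε / 2) (by positivity)
  have hlim : Filter.Tendsto (fun N : ℕ => ∑ n ∈ Finset.range M,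
      (N.choose n : ℝ) * (1 - p) ^ (N - n) * (p ^ n * |g n - L|)) Filter.atTop (nhds 0) := by
    have := tendsto_finsetSum (Finset.range M) fun n _ =>
      (tendsto_choose_mul_pow_sub hq0 hq1 n).mul_const (p ^ n * |g n - L|)
    simpa using this
  obtain ⟨N₀, hN₀⟩ := Filter.eventually_atTop.1 (hlim.eventually_lt_const (half_pos hε))
  refine ⟨max N₀ M, fun N hN => ?_⟩
  have hN1 := hN₀ N (le_of_max_le_left hN)
  have hsub : binomialMean p g N - L = binomialMean p (fun n => g n - L) N := by
    have := binomialMean_add p (fun n => g n - L) (fun _ => L) N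
    simp only [sub_add_cancel, binomialMean_const] at this
    linarith
  have hone := binomialMean_const p (ε / 2) N
  rw [Real.dist_eq, hsub]
  calc |binomialMean p (fun n => g n - L) N|
      ≤ ∑ n ∈ Finset.range (N + 1),
          (N.choose n : ℝ) * p ^ n * (1 - p) ^ (N - n) * |g n - L| := by
        refine (Finset.abs_sum_le_sum_abs _ _).trans_eq (Finset.sum_congr rfl fun n _ => ?_)
        rw [abs_mul, abs_of_nonneg (a := (N.choose n : ℝ) * p ^ n * (1 - p) ^ (N - n))
          (by positivity)]
    _ ≤ ∑ n ∈ Finset.range (N + 1),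
          ((if n < M then (N.choose n : ℝ) * (1 - p) ^ (N - n) * (p ^ n * |g n - L|) else 0) +
            (N.choose n : ℝ) * p ^ n * (1 - p) ^ (N - n) * (ε / 2)) := by
        refine Finset.sum_le_sum fun n _ => ?_
        split_ifs with hn
        · have : 0 ≤ (N.choose n : ℝ) * p ^ n * (1 - p) ^ (N - n) * (ε / 2) := by positivity
          linarith
        · have := (hM n (not_lt.1 hn)).le
          rw [Real.dist_eq] at this
          rw [zero_add]
          gcongr
    _ = (∑ n ∈ Finset.range M,
          (N.choose n : ℝ) * (1 - p) ^ (N - n) * (p ^ n * |g n - L|)) + ε / 2 := by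
        rw [Finset.sum_add_distrib, ← Finset.sum_filter]
        congr 2
        ext n
        have := le_of_max_le_right hN
        simp only [Finset.mem_filter, Finset.mem_range]
        omega
    _ < ε := by linarith

/-! ### Truncated nested sums and convergence of the series -/

/-- The sum of `∏ᵢ wᵢ(nᵢ)` over `N ≥ n₁ ≥ ⋯ ≥ n_k ≥ 1`. -/
noncomputable def nestedSum : List (ℕ → ℝ) → ℕ → ℝ
  | [], _ => 1
  | w :: l, N => ∑ n ∈ Finset.Icc 1 N, w n * nestedSum l n

namespace StarIndex

theorem finite_le (k N : ℕ) : {n : StarIndex k | ∀ i, n.1 i ≤ N}.Finite :=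
  ((Set.finite_Icc (0 : Fin k → ℕ) fun _ => N).preimage
    Subtype.val_injective.injOn).subset fun _ hn => ⟨fun _ => Nat.zero_le _, hn⟩

/-- The indices all of whose entries are at most `N`. -/
noncomputable def box (k N : ℕ) : Finset (StarIndex k) := (finite_le k N).toFinset

theorem mem_box {k N : ℕ} {n : StarIndex k} : n ∈ box k N ↔ ∀ i, n.1 i ≤ N := by
  simp [box]

theorem monotone_box (k : ℕ) : Monotone (box k) := fun _ _ h _ hn =>
  mem_box.2 fun i => (mem_box.1 hn i).trans h

theorem tendsto_box (k : ℕ) : Filter.Tendsto (box k) Filter.atTop Filter.atTop :=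
  Filter.tendsto_atTop_finset_of_monotone (monotone_box k) fun n =>
    ⟨∑ i, n.1 i, mem_box.2 fun i => Finset.single_le_sum (f := n.1) (fun _ _ => Nat.zero_le _)
      (Finset.mem_univ i)⟩

/-- The index obtained by putting a first entry in front. -/
def cons {k : ℕ} (a : ℕ) (t : StarIndex k) (ha : 1 ≤ a) (h : ∀ i, t.1 i ≤ a) :
    StarIndex (k + 1) :=
  ⟨Fin.cons a t.1, by
    refine ⟨fun i j hij => ?_, fun i => ?_⟩
    · induction i using Fin.cases with
      | zero =>
        induction j using Fin.cases with
        | zero => exact le_rfl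
        | succ j => simpa using h j
      | succ i =>
        induction j using Fin.cases with
        | zero => exact absurd hij (by simp)
        | succ j => simpa using t.2.1 (Fin.succ_le_succ_iff.1 hij)
    · induction i using Fin.cases with
      | zero => simpa using ha
      | succ i => simpa using t.2.2 i⟩

/-- The index obtained by removing the first entry. -/
def tail {k : ℕ} (n : StarIndex (k + 1)) : StarIndex k :=
  ⟨Fin.tail n.1, fun _ _ h => n.2.1 (Fin.succ_le_succ_iff.2 h), fun i => n.2.2 i.succ⟩

theorem sum_box (k : ℕ) (w : Fin k → ℕ → ℝ) (N : ℕ) :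
    ∑ n ∈ box k N, ∏ i, w i (n.1 i) = nestedSum (List.ofFn w) N := by
  induction k generalizing N with
  | zero =>
    have : ∃ t : StarIndex 0, box 0 N = {t} := by
      refine ⟨⟨fun _ => 0, antitone_const, fun i => i.elim0⟩, Finset.ext fun n => ?_⟩
      refine iff_of_true (mem_box.2 fun i => i.elim0) (Finset.mem_singleton.2 ?_)
      exact Subtype.ext (Subsingleton.elim (α := Fin 0 → ℕ) _ _)
    obtain ⟨t, ht⟩ := this
    rw [ht, Finset.sum_singleton]
    simp [nestedSum]
  | succ k ih =>
    rw [List.ofFn_succ, nestedSum]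
    simp_rw [← ih, Finset.mul_sum]
    rw [Finset.sum_sigma']
    refine Finset.sum_bij' (fun n _ => ⟨n.1 0, tail n⟩)
      (fun x hx => cons x.1 x.2 (Finset.mem_Icc.1 (Finset.mem_sigma.1 hx).1).1
        (mem_box.1 (Finset.mem_sigma.1 hx).2)) ?_ ?_ ?_ ?_ ?_
    · intro n hn
      refine Finset.mem_sigma.2 ⟨Finset.mem_Icc.2 ⟨n.2.2 0, mem_box.1 hn 0⟩,
        mem_box.2 fun i => n.2.1 (Fin.zero_le _)⟩
    · intro x hx
      obtain ⟨h1, h2⟩ := Finset.mem_sigma.1 hx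
      refine mem_box.2 fun i => ?_
      induction i using Fin.cases with
      | zero => exact (Finset.mem_Icc.1 h1).2
      | succ i => exact (mem_box.1 h2 i).trans (Finset.mem_Icc.1 h1).2
    · intro n _
      exact Subtype.ext (Fin.cons_self_tail n.1)
    · intro x _
      rfl
    · intro n _
      rw [Fin.prod_univ_succ]
      rfl

end StarIndex

theorem starTerm_nonneg {k : ℕ} (s : Fin k → ℕ) {x : Fin k → ℝ} (hx : ∀ i, 0 ≤ x i)
    (n : StarIndex k) : 0 ≤ starTerm s x n :=
  Finset.prod_nonneg fun i _ => div_nonneg (pow_nonneg (hx i) _) (by positivity)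

/-- The weight `n ↦ x ^ n / n ^ s` of an entry of a multiple polylogarithm series. -/
noncomputable def starWeight (s : ℕ) (x : ℝ) (n : ℕ) : ℝ := x ^ n / (n : ℝ) ^ s

theorem sum_box_starTerm {k : ℕ} (s : Fin k → ℕ) (x : Fin k → ℝ) (N : ℕ) :
    ∑ n ∈ StarIndex.box k N, starTerm s x n =
      nestedSum (List.ofFn fun i => starWeight (s i) (x i)) N :=
  StarIndex.sum_box k (fun i => starWeight (s i) (x i)) N

/-- Every finite set of indices lies in arbitrarily large boxes, so an eventual bound on box sums
bounds all finite sums of the nonnegative terms. -/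
theorem starPolylogConverges_of_nestedSum_le {k : ℕ} (s : Fin k → ℕ) {x : Fin k → ℝ}
    (hx : ∀ i, 0 ≤ x i) {C : ℝ}
    (hC : ∀ᶠ N in Filter.atTop, nestedSum (List.ofFn fun i => starWeight (s i) (x i)) N ≤ C) :
    StarPolylogConverges s x := by
  refine summable_of_sum_le (c := C) (starTerm_nonneg s hx) fun t => ?_
  obtain ⟨N, hN, ht⟩ := (hC.and
    ((StarIndex.tendsto_box k).eventually (Filter.eventually_ge_atTop t))).exists
  rw [← sum_box_starTerm] at hN
  exact (Finset.sum_le_sum_of_subset_of_nonneg ht fun n _ _ => starTerm_nonneg s hx n).trans hN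

theorem StarPolylogConverges.tendsto_nestedSum {k : ℕ} {s : Fin k → ℕ} {x : Fin k → ℝ}
    (h : StarPolylogConverges s x) :
    Filter.Tendsto (nestedSum (List.ofFn fun i => starWeight (s i) (x i))) Filter.atTop
      (nhds (starPolylog s x)) := by
  have := (Summable.hasSum h).comp (StarIndex.tendsto_box k)
  refine this.congr fun N => ?_
  exact sum_box_starTerm s x N

/-! ### Block operators and their intertwining by binomial means -/

/-- The operator on sequences attached to a block `{m + 2, {1}_u}`. -/
noncomputable def blockOp (y : ℝ) (b : ℕ × ℕ) (g : ℕ → ℝ) : ℕ → ℝ :=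
  dividedSum 1 ((dividedSum y)^[b.1 + 1] ((dividedSum 1)^[b.2] g))

/-- The composition of the operators attached to a list of blocks. -/
noncomputable def blockOps (y : ℝ) (bs : List (ℕ × ℕ)) (g : ℕ → ℝ) : ℕ → ℝ :=
  bs.foldr (blockOp y) g

theorem iterate_dividedSum_sub (y : ℝ) (k : ℕ) (g h : ℕ → ℝ) :
    (dividedSum y)^[k] (g - h) = (dividedSum y)^[k] g - (dividedSum y)^[k] h := by
  induction k generalizing g h with
  | zero => rfl
  | succ k ih => simp only [Function.iterate_succ_apply, dividedSum_sub, ih]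

theorem iterate_dividedSum_smul (y c : ℝ) (k : ℕ) (g : ℕ → ℝ) :
    (dividedSum y)^[k] (c • g) = c • (dividedSum y)^[k] g := by
  induction k generalizing g with
  | zero => rfl
  | succ k ih => simp only [Function.iterate_succ_apply, dividedSum_smul, ih]

theorem iterate_dividedSum_mono {y : ℝ} (hy : 0 ≤ y) {g h : ℕ → ℝ}
    (hgh : ∀ n, 1 ≤ n → g n ≤ h n) (k n : ℕ) (hn : 1 ≤ n) :
    (dividedSum y)^[k] g n ≤ (dividedSum y)^[k] h n := by
  induction k generalizing g h with
  | zero => exact hgh n hn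
  | succ k ih => exact ih fun n _ => dividedSum_mono hy hgh n

theorem blockOps_sub (y : ℝ) (bs : List (ℕ × ℕ)) (g h : ℕ → ℝ) :
    blockOps y bs (g - h) = blockOps y bs g - blockOps y bs h := by
  induction bs with
  | nil => rfl
  | cons b bs ih =>
    simp only [blockOps, List.foldr_cons] at ih ⊢
    rw [ih]
    simp only [blockOp, iterate_dividedSum_sub, dividedSum_sub]

theorem blockOps_smul (y c : ℝ) (bs : List (ℕ × ℕ)) (g : ℕ → ℝ) :
    blockOps y bs (c • g) = c • blockOps y bs g := by
  induction bs with
  | nil => rfl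
  | cons b bs ih =>
    simp only [blockOps, List.foldr_cons] at ih ⊢
    rw [ih]
    simp only [blockOp, iterate_dividedSum_smul, dividedSum_smul]

theorem blockOp_mono {y : ℝ} (hy : 0 ≤ y) (b : ℕ × ℕ) {g h : ℕ → ℝ}
    (hgh : ∀ n, 1 ≤ n → g n ≤ h n) (N : ℕ) : blockOp y b g N ≤ blockOp y b h N :=
  dividedSum_mono zero_le_one (iterate_dividedSum_mono hy
    (iterate_dividedSum_mono zero_le_one hgh b.2) (b.1 + 1)) N

theorem blockOps_mono {y : ℝ} (hy : 0 ≤ y) (bs : List (ℕ × ℕ)) {g h : ℕ → ℝ}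
    (hgh : ∀ n, 1 ≤ n → g n ≤ h n) {n : ℕ} (hn : 1 ≤ n) :
    blockOps y bs g n ≤ blockOps y bs h n := by
  induction bs generalizing n with
  | nil => exact hgh n hn
  | cons b bs ih => exact blockOp_mono hy b (fun n hn => ih hn) n

theorem iterate_dividedSum_zero_right (y : ℝ) {g : ℕ → ℝ} (hg : g 0 = 0) (k : ℕ) :
    (dividedSum y)^[k] g 0 = 0 := by
  cases k with
  | zero => exact hg
  | succ k => rw [Function.iterate_succ_apply', dividedSum_zero_right]

theorem binomialMean_iterate_dividedSum {p y z : ℝ}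
    (h : ∀ g : ℕ → ℝ, g 0 = 0 → binomialMean p (dividedSum y g) = dividedSum z (binomialMean p g))
    {g : ℕ → ℝ} (hg : g 0 = 0) (k : ℕ) :
    binomialMean p ((dividedSum y)^[k] g) = (dividedSum z)^[k] (binomialMean p g) := by
  induction k generalizing g with
  | zero => rfl
  | succ k ih =>
    rw [Function.iterate_succ_apply, ih (dividedSum_zero_right y g), h g hg,
      Function.iterate_succ_apply]

theorem binomialMean_blockOps (p : ℝ) (bs : List (ℕ × ℕ)) {g : ℕ → ℝ} (hg : g 0 = 0) :
    binomialMean p (blockOps 0 bs g) = blockOps (1 - p) bs (binomialMean p g) := by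
  induction bs with
  | nil => rfl
  | cons b bs ih =>
    have h0 : blockOps 0 bs g 0 = 0 := by
      cases bs with
      | nil => exact hg
      | cons b bs =>
        exact dividedSum_zero_right 1
          ((dividedSum 0)^[b.1 + 1] ((dividedSum 1)^[b.2] (blockOps 0 bs g)))
    simp only [blockOps, List.foldr_cons] at ih h0 ⊢
    have h1 := iterate_dividedSum_zero_right 1 h0 b.2
    rw [blockOp, binomialMean_dividedSum_one_left p (iterate_dividedSum_zero_right 0 h1 _),
      binomialMean_iterate_dividedSum (fun g => binomialMean_dividedSum_zero_left p) h1,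
      binomialMean_iterate_dividedSum (fun g => binomialMean_dividedSum_one_left p) h0, ih, blockOp]

/-! ### Boundedness of the truncated zeta-star series -/

/-- D_1 does not preserve boundedness (it produces logarithms), but it does preserve growth O(√n).
-/
theorem dividedSum_one_sqrt_le (N : ℕ) :
    dividedSum 1 (fun n => √(n : ℝ)) N ≤ 2 * √(N : ℝ) := by
  induction N with
  | zero => simp [dividedSum_zero_right]
  | succ N ih =>
    rw [dividedSum_succ, one_mul]
    have hb : 0 < √((N + 1 : ℕ) : ℝ) := by positivity
    have ha : 0 ≤ √(N : ℝ) := by positivity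
    have h1 : √(N : ℝ) ^ 2 = N := Real.sq_sqrt (by positivity)
    have h2 : √((N + 1 : ℕ) : ℝ) ^ 2 = N + 1 := by
      rw [Real.sq_sqrt (by positivity)]
      push_cast
      rfl
    have hab : √(N : ℝ) ≤ √((N + 1 : ℕ) : ℝ) := Real.sqrt_le_sqrt (by push_cast; linarith)
    rw [Real.sqrt_div_self]
    have : (√((N + 1 : ℕ) : ℝ))⁻¹ ≤ 2 * (√((N + 1 : ℕ) : ℝ) - √(N : ℝ)) := by
      -- With a = √N and b = √(N+1): 2b(b - a) = (b² - a²) + (b - a)² ≥ 1.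
      rw [inv_le_iff_one_le_mul₀ hb]
      nlinarith
    linarith

theorem iterate_dividedSum_one_le_sqrt {g : ℕ → ℝ} {C : ℝ} (hC : 0 ≤ C)
    (hg : ∀ n, 1 ≤ n → g n ≤ C * √(n : ℝ)) (k n : ℕ) (hn : 1 ≤ n) :
    (dividedSum 1)^[k] g n ≤ 2 ^ k * C * √(n : ℝ) := by
  induction k generalizing g C with
  | zero => simpa using hg n hn
  | succ k ih =>
    refine (ih (C := 2 * C) (by positivity) fun n _ => ?_).trans_eq (by ring)
    have h1 := dividedSum_mono zero_le_one hg n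
    have h2 := congrFun (dividedSum_smul 1 C fun n => √(n : ℝ)) n
    have h3 := mul_le_mul_of_nonneg_left (dividedSum_one_sqrt_le n) hC
    simp only [Pi.smul_def, smul_eq_mul] at h2
    linarith

/-- The trailing ones keep growth O(√j), and the leading exponent, at least 2, leaves a sum
dominated by ∑ j^(-3/2). -/
theorem exists_blockOp_zero_le (b : ℕ × ℕ) {g : ℕ → ℝ} {C : ℝ} (hC : 0 ≤ C)
    (hg : ∀ n, 1 ≤ n → g n ≤ C * √(n : ℝ)) : ∃ C', 0 ≤ C' ∧ ∀ N, blockOp 0 b g N ≤ C' := by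
  have hs : Summable fun n : ℕ => 1 / (n : ℝ) ^ (3 / 2 : ℝ) :=
    Real.summable_one_div_nat_rpow.2 (by norm_num)
  refine ⟨2 ^ b.2 * C * ∑' n : ℕ, 1 / (n : ℝ) ^ (3 / 2 : ℝ), mul_nonneg (by positivity)
    (tsum_nonneg fun n => by positivity), fun N => ?_⟩
  refine le_trans ?_ (mul_le_mul_of_nonneg_left
    (hs.sum_le_tsum (Finset.Icc 1 N) fun n _ => by positivity) (by positivity))
  rw [blockOp, dividedSum, Finset.mul_sum]
  refine Finset.sum_le_sum fun j hj => ?_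
  have hj1 := (Finset.mem_Icc.1 hj).1
  have hj' : (1 : ℝ) ≤ j := by exact_mod_cast hj1
  have hj0 : (0 : ℝ) < j := by linarith
  have h1 := iterate_dividedSum_one_le_sqrt hC hg b.2 j hj1
  have h2 : √(j : ℝ) / j / j = 1 / (j : ℝ) ^ (3 / 2 : ℝ) := by
    have h : (j : ℝ) ^ (3 / 2 : ℝ) = j * √(j : ℝ) := by
      rw [Real.sqrt_eq_rpow, show (3 / 2 : ℝ) = 1 + 1 / 2 by norm_num, Real.rpow_add hj0,
        Real.rpow_one]
    rw [h, Real.sqrt_div_self, one_div, mul_inv, div_eq_inv_mul]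
  rw [one_pow, one_mul, iterate_dividedSum_zero_left _ hj1, ← h2]
  calc _ ≤ 2 ^ b.2 * C * √(j : ℝ) / (j : ℝ) ^ (b.1 + 1) / j := by gcongr
    _ ≤ 2 ^ b.2 * C * √(j : ℝ) / (j : ℝ) ^ 1 / j := by
      gcongr
      omega
    _ = _ := by ring

theorem exists_blockOps_zero_one_le (bs : List (ℕ × ℕ)) :
    ∃ C, 0 ≤ C ∧ ∀ N, blockOps 0 bs 1 N ≤ C := by
  induction bs with
  | nil => exact ⟨1, zero_le_one, fun _ => le_rfl⟩
  | cons b bs ih =>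
    obtain ⟨C, hC, h⟩ := ih
    refine exists_blockOp_zero_le b hC fun n hn => (h n).trans (le_mul_of_one_le_right hC ?_)
    rw [Real.one_le_sqrt]
    exact_mod_cast hn

/-! ### Truncated series as compositions of block operators -/

/-- Splitting y^N = y^(N-j) y^j moves the power inside the sum, onto the next argument. -/
theorem pow_mul_nestedSum_cons (x y : ℝ) (l : List (ℕ → ℝ)) :
    (fun n => y ^ n * nestedSum (starWeight 1 x :: l) n) =
      dividedSum y fun n => (y * x) ^ n * nestedSum l n := by
  ext N
  rw [nestedSum, dividedSum, Finset.mul_sum]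
  refine Finset.sum_congr rfl fun j hj => ?_
  rw [← pow_sub_mul_pow y (Finset.mem_Icc.1 hj).2, starWeight, mul_pow, pow_one]
  ring

theorem pow_mul_nestedSum_replicate (y : ℝ) (u : ℕ) (l : List (ℕ → ℝ)) :
    (fun n => y ^ n * nestedSum (List.replicate u (starWeight 1 1) ++ l) n) =
      (dividedSum y)^[u] fun n => y ^ n * nestedSum l n := by
  induction u with
  | zero => rfl
  | succ u ih =>
    rw [List.replicate_succ, List.cons_append, pow_mul_nestedSum_cons, mul_one, ih,
      Function.iterate_succ_apply']

theorem nestedSum_replicate (u : ℕ) (l : List (ℕ → ℝ)) :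
    nestedSum (List.replicate u (starWeight 1 1) ++ l) = (dividedSum 1)^[u] (nestedSum l) := by
  simpa using pow_mul_nestedSum_replicate 1 u l

theorem nestedSum_cons (x : ℝ) (l : List (ℕ → ℝ)) :
    nestedSum (starWeight 1 x :: l) = dividedSum 1 fun n => x ^ n * nestedSum l n := by
  simpa using pow_mul_nestedSum_cons x 1 l

/-- The power q^n opened by the first argument is carried through the ones, each giving a D_q, until
1/q cancels it. -/
theorem nestedSum_argBlock {q : ℝ} (hq : q ≠ 0) (b : ℕ × ℕ) (l : List (ℕ → ℝ)) :
    nestedSum (([q] ++ List.replicate b.1 1 ++ [1 / q] ++ List.replicate b.2 1).map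
      (starWeight 1) ++ l) = blockOp q b (nestedSum l) := by
  simp only [List.map_append, List.map_cons, List.map_replicate,
    List.append_assoc, List.cons_append, List.nil_append]
  rw [nestedSum_cons, pow_mul_nestedSum_replicate, pow_mul_nestedSum_cons,
    mul_one_div_cancel hq, nestedSum_replicate, blockOp, Function.iterate_succ_apply]
  simp only [one_pow, one_mul]

theorem nestedSum_argBlocks {q : ℝ} (hq : q ≠ 0) (bs : List (ℕ × ℕ)) (l : List (ℕ → ℝ)) :
    nestedSum ((bs.map fun b => [q] ++ List.replicate b.1 1 ++ [1 / q] ++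
      List.replicate b.2 1).flatten.map (starWeight 1) ++ l) = blockOps q bs (nestedSum l) := by
  induction bs with
  | nil => rfl
  | cons b bs ih =>
    rw [List.map_cons, List.flatten_cons, List.map_append, List.append_assoc,
      nestedSum_argBlock hq, ih]
    rfl

/-- D_0 divides by n, so m + 1 copies of it and the outer D_1 produce the exponent m + 2. -/
theorem nestedSum_exponentBlock (b : ℕ × ℕ) (l : List (ℕ → ℝ)) :
    nestedSum (((b.1 + 2) :: List.replicate b.2 1).map (starWeight · 1) ++ l) =
      blockOp 0 b (nestedSum l) := by
  ext N
  rw [List.map_cons, List.map_replicate, List.cons_append, nestedSum, nestedSum_replicate,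
    blockOp, dividedSum]
  refine Finset.sum_congr rfl fun j hj => ?_
  rw [iterate_dividedSum_zero_left _ (Finset.mem_Icc.1 hj).1, starWeight, one_pow, one_pow,
    div_div, ← pow_succ]
  ring

theorem nestedSum_exponentBlocks (bs : List (ℕ × ℕ)) :
    nestedSum ((bs.map fun b => (b.1 + 2) :: List.replicate b.2 1).flatten.map (starWeight · 1)) =
      blockOps 0 bs 1 := by
  induction bs with
  | nil => rfl
  | cons b bs ih =>
    rw [List.map_cons, List.flatten_cons, List.map_append, nestedSum_exponentBlock, ih]
    rfl

theorem nestedSum_blockExponents {d : ℕ} (m u : Fin d → ℕ) :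
    nestedSum ((blockExponents m u).map (starWeight · 1)) =
      blockOps 0 (List.ofFn fun i => (m i, u i)) 1 := by
  rw [← nestedSum_exponentBlocks, List.map_ofFn]
  rfl

theorem nestedSum_blockArgs_append {p : ℝ} (hp : p < 1) {d : ℕ} (m u : Fin d → ℕ)
    (l : List (ℕ → ℝ)) :
    nestedSum ((blockArgs p m u).map (starWeight 1) ++ l) =
      blockOps (1 - p) (List.ofFn fun i => (m i, u i)) (nestedSum l) := by
  rw [← nestedSum_argBlocks (sub_ne_zero.2 hp.ne'), List.map_ofFn]
  rfl

theorem nestedSum_blockArgs {p : ℝ} (hp : p < 1) {d : ℕ} (m u : Fin d → ℕ) :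
    nestedSum ((blockArgs p m u).map (starWeight 1)) =
      blockOps (1 - p) (List.ofFn fun i => (m i, u i)) 1 := by
  have := nestedSum_blockArgs_append hp m u []
  rwa [List.append_nil] at this

theorem nestedSum_blockArgsEnd {p : ℝ} (hp : p < 1) {d : ℕ} (hd : 1 ≤ d) (m u : Fin d → ℕ)
    (hu : 1 ≤ u ⟨d - 1, by omega⟩) :
    nestedSum ((blockArgsEnd p m u).map (starWeight 1)) =
      blockOps (1 - p) (List.ofFn fun i => (m i, u i)) fun n => (1 - p) ^ n := by
  obtain ⟨d, rfl⟩ := Nat.exists_eq_add_of_le' hd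
  obtain ⟨v, hv⟩ := Nat.exists_eq_add_of_le' (show 1 ≤ u (Fin.last d) from hu)
  have hcast : ∀ i : Fin d, u i.castSucc - deltaLast i.castSucc = u i.castSucc := fun i => by
    have := i.2.ne
    simp [deltaLast, this]
  have hlast : v + 1 - deltaLast (Fin.last d) = v := by
    simp [deltaLast]
  rw [blockArgsEnd, List.map_append, nestedSum_blockArgs_append hp]
  simp only [List.ofFn_succ_last, hcast, hlast, hv, blockOps, List.foldr_append, List.foldr_cons,
    List.foldr_nil]
  -- The final argument 1 - p replaces the deleted last 1: it supplies the innermost D_1, applied to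
  -- (1-p)^n.
  congr 1
  rw [List.map_cons, List.map_nil, nestedSum_cons]
  simp only [nestedSum, mul_one]
  rfl

/-! ### Passage to the limit and the main theorem -/

theorem blockOps_congr {y : ℝ} (hy : 0 ≤ y) (bs : List (ℕ × ℕ)) {g h : ℕ → ℝ}
    (hgh : ∀ n, 1 ≤ n → g n = h n) {n : ℕ} (hn : 1 ≤ n) :
    blockOps y bs g n = blockOps y bs h n :=
  le_antisymm (blockOps_mono hy bs (fun n hn => (hgh n hn).le) hn)
    (blockOps_mono hy bs (fun n hn => (hgh n hn).ge) hn)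

theorem tendsto_blockOps_sub_blockOps {p L : ℝ} (hp : p ∈ Set.Ioo (0 : ℝ) 1)
    {bs : List (ℕ × ℕ)}
    (h : Filter.Tendsto (blockOps 0 bs 1) Filter.atTop (nhds L)) :
    Filter.Tendsto (blockOps (1 - p) bs 1 - blockOps (1 - p) bs fun n => (1 - p) ^ n)
      Filter.atTop (nhds L) := by
  -- Changing the input at 0 affects no value at n ≥ 1, and the intertwining requires it to vanish
  -- there.
  have h1 : Filter.Tendsto (blockOps 0 bs fun n => if n = 0 then 0 else 1) Filter.atTop
      (nhds L) := by
    refine h.congr' ?_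
    filter_upwards [Filter.eventually_ge_atTop 1] with n hn
    exact blockOps_congr le_rfl bs (fun n hn => by simp [Nat.one_le_iff_ne_zero.1 hn]) hn
  have h2 := tendsto_binomialMean hp h1
  rw [binomialMean_blockOps p bs (by simp)] at h2
  rw [← blockOps_sub]
  convert h2 using 2
  ext n
  rw [binomialMean_pos_indicator]
  rfl

theorem ofFn_starWeight_get {k : ℕ} (l : List ℝ) (h : l.length = k) :
    List.ofFn (fun j : Fin k => starWeight 1 (l.get (j.cast h.symm))) =
      l.map (starWeight 1) := by
  subst h
  conv_rhs => rw [← List.ofFn_get l, List.map_ofFn]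
  rfl

theorem ofFn_starWeight_one (s : List ℕ) :
    List.ofFn (fun j => starWeight (s.get j) 1) = s.map (starWeight · 1) := by
  conv_rhs => rw [← List.ofFn_get s, List.map_ofFn]
  rfl

theorem nonneg_of_mem_blockArgs {p : ℝ} (hp : p < 1) {d : ℕ} (m u : Fin d → ℕ) {a : ℝ}
    (ha : a ∈ blockArgs p m u) : 0 ≤ a := by
  have hq : 0 < 1 - p := by linarith
  simp only [blockArgs, List.mem_flatten, List.mem_ofFn, exists_exists_eq_and,
    List.mem_append, List.mem_singleton, List.mem_replicate] at ha
  obtain ⟨i, ((rfl | ⟨-, rfl⟩) | rfl) | ⟨-, rfl⟩⟩ := ha <;> positivity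

theorem mainTheorem10 (d : ℕ) (hd : 1 ≤ d) (m u : Fin d → ℕ)
    (hu : 1 ≤ u ⟨d - 1, by omega⟩) (p : ℝ) (hp : p ∈ Set.Ioo (0 : ℝ) 1) :
    let s : List ℕ := blockExponents m u
    let x : Fin s.sum → ℝ := fun j =>
      (blockArgs p m u).get (j.cast (length_blockArgs p m u).symm)
    let y : Fin s.sum → ℝ := fun j =>
      (blockArgsEnd p m u).get (j.cast (length_blockArgsEnd p hd m u hu).symm)
    StarPolylogConverges s.get (fun _ => 1) ∧
    StarPolylogConverges (fun _ : Fin s.sum => 1) x ∧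
    StarPolylogConverges (fun _ : Fin s.sum => 1) y ∧
    zetaStar s =
      starPolylog (fun _ : Fin s.sum => 1) x - starPolylog (fun _ : Fin s.sum => 1) y := by
  intro s x y
  have hq : 0 < 1 - p := by linarith [hp.2]
  set bs : List (ℕ × ℕ) := List.ofFn fun i => (m i, u i)
  have es : nestedSum (List.ofFn fun j => starWeight (s.get j) 1) = blockOps 0 bs 1 := by
    rw [ofFn_starWeight_one, nestedSum_blockExponents]
  have ex : nestedSum (List.ofFn fun j => starWeight 1 (x j)) = blockOps (1 - p) bs 1 := by
    rw [ofFn_starWeight_get _ (length_blockArgs p m u), nestedSum_blockArgs hp.2]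
  have ey : nestedSum (List.ofFn fun j => starWeight 1 (y j)) =
      blockOps (1 - p) bs fun n => (1 - p) ^ n := by
    rw [ofFn_starWeight_get _ (length_blockArgsEnd p hd m u hu),
      nestedSum_blockArgsEnd hp.2 hd m u hu]
  have hx0 : ∀ i, 0 ≤ x i := fun i => nonneg_of_mem_blockArgs hp.2 m u (List.get_mem _ _)
  have hy0 : ∀ i, 0 ≤ y i := fun i => by
    have : y i ∈ blockArgsEnd p m u := List.get_mem _ _
    rcases List.mem_append.1 this with h | h
    · exact nonneg_of_mem_blockArgs hp.2 _ _ h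
    · rw [List.mem_singleton.1 h]
      exact hq.le
  have cs : StarPolylogConverges s.get (fun _ => 1) := by
    obtain ⟨C, -, hC⟩ := exists_blockOps_zero_one_le bs
    refine starPolylogConverges_of_nestedSum_le _ (fun _ => zero_le_one)
      (Filter.Eventually.of_forall (p := fun N => _ ≤ C) fun N => ?_)
    rw [es]
    exact hC N
  have ts := cs.tendsto_nestedSum
  rw [es] at ts
  have ht := tendsto_blockOps_sub_blockOps hp ts
  -- For n ≥ 1, 1 - (1-p)^n ≥ p, so by monotonicity the first truncated polylogarithm is at most p⁻¹
  -- times the convergent difference.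
  have hbound : ∀ᶠ N in Filter.atTop,
      blockOps (1 - p) bs 1 N ≤ p⁻¹ * (starPolylog s.get (fun _ => 1) + 1) := by
    filter_upwards [ht.eventually_le_const (lt_add_one _), Filter.eventually_ge_atTop 1]
      with N hN hN1
    have h : blockOps (1 - p) bs 1 N ≤
        blockOps (1 - p) bs (p⁻¹ • (1 - fun n => (1 - p) ^ n)) N := by
      refine blockOps_mono hq.le bs (fun n hn => ?_) hN1
      have h1 : (1 - p) ^ n ≤ 1 - p :=
        pow_le_of_le_one hq.le (by linarith [hp.1]) (Nat.one_le_iff_ne_zero.1 hn)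
      simp only [Pi.smul_apply, Pi.sub_apply, Pi.one_apply, smul_eq_mul]
      rw [← div_eq_inv_mul, le_div_iff₀ hp.1]
      linarith
    rw [blockOps_smul, blockOps_sub] at h
    exact h.trans (mul_le_mul_of_nonneg_left hN (inv_nonneg.2 hp.1.le))
  have cx : StarPolylogConverges (fun _ : Fin s.sum => 1) x :=
    starPolylogConverges_of_nestedSum_le _ hx0 (by rwa [ex])
  have cy : StarPolylogConverges (fun _ : Fin s.sum => 1) y := by
    refine starPolylogConverges_of_nestedSum_le _ hy0
      (C := p⁻¹ * (starPolylog s.get (fun _ => 1) + 1)) ?_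
    rw [ey]
    filter_upwards [hbound, Filter.eventually_ge_atTop 1] with N hN hN1
    exact (blockOps_mono hq.le bs
      (fun n _ => pow_le_one₀ hq.le (by linarith [hp.1])) hN1).trans hN
  have tx := cx.tendsto_nestedSum
  have ty := cy.tendsto_nestedSum
  rw [ex] at tx
  rw [ey] at ty
  exact ⟨cs, cx, cy, tendsto_nhds_unique ht (tx.sub ty)⟩
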